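/- For partially ordered sets $P,Q$, write $P\preceq Q$ if there is a monotone map $\psi\colon P\to Q$ whose image is cofinal in $Q$ (for every $q\in Q$ there is $p\in P$ with $q\le\psi(p)$), and $P\approx Q$ (cofinal equivalence) if $P\preceq Q$ and $Q\preceq P$. For a metric space $X$, let $\mathrm{PK}(X)$ be the family of precompact (i.e., totally bounded) subsets of $X$, ordered by inclusion. For a topological space $Y$, let $d(Y)$ be the density of $Y$, that is, the minimal cardinality of a dense subset; for a point $y\in Y$, let $\mathrm{ld}(y)$ be the minimal density of a neighborhood of $y$ (with the subspace topology), and let the local density of $Y$ be $\mathrm{ld}(Y)=\sup_{y\in Y}\mathrm{ld}(y)$. The local density of $Y$ is realized if $\mathrm{ld}(y)=\mathrm{ld}(Y)$ for some $y\in Y$. For a cardinal $\kappa$, identified with the set of ordinals smaller than $\kappa$, let $\mathrm{fin}(\kappa)$ be the set of finite subsets of $\kappa$ ordered by inclusion, let $\mathrm{fin}(\kappa)^{\mathbb N}$ be the set of functions $\mathbb N\to\mathrm{fin}(\kappa)$ with the pointwise order, and let $\mathrm{Bdd}(\mathrm{fin}(\kappa)^{\mathbb N})=\bigcup_{\alpha<\kappa}\mathrm{fin}(\alpha)^{\mathbb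 N}$ (the union over all ordinals $\alpha<\kappa$) with the induced order. Products carry the coordinatewise order. **Theorem.** Let $X$ be a metric space whose completion $\tilde X$ is not locally compact. 1. If the local density of $\tilde X$ is not realized, then $$\mathrm{PK}(X)\approx \mathrm{fin}(d(X))\times \mathrm{Bdd}\bigl(\mathrm{fin}(\mathrm{ld}(\tilde X))^{\mathbb N}\bigr).$$ 2. If the local density of $\tilde X$ is realized, or the cofinality of the cardinal $\mathrm{ld}(\tilde X)$ is uncountable, then $$\mathrm{PK}(X)\approx \mathrm{fin}(d(X))\times \mathrm{fin}(\mathrm{ld}(\tilde X))^{\mathbb N}.$$ -/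

import Mathlib

open Topology Cardinal

namespace CofinalStructure

universe u v

/-- `CofinalMapTo P Q` (in symbols `P ≼ Q`): there is a monotone map `P → Q` with cofinal image. -/
def CofinalMapTo (P : Type u) (Q : Type v) [PartialOrder P] [PartialOrder Q] : Prop :=
  ∃ ψ : P → Q, Monotone ψ ∧ IsCofinal (Set.range ψ)

/-- Cofinal equivalence `P ≈ Q`: both `P ≼ Q` and `Q ≼ P`. -/
def CofinallyEquivalent (P : Type u) (Q : Type v) [PartialOrder P] [PartialOrder Q] : Prop :=
  CofinalMapTo P Q ∧ CofinalMapTo Q P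

/-- The family of precompact (totally bounded) subsets of `X`, ordered by inclusion. -/
abbrev PK (X : Type u) [UniformSpace X] : Type u :=
  {P : Set X // TotallyBounded P}

/-- The density of a space: the minimal cardinality of a dense subset. -/
noncomputable def density (X : Type u) [TopologicalSpace X] : Cardinal.{u} :=
  ⨅ D : {D : Set X // Dense D}, #D.1

/-- The local density of a point: the minimal density of a neighborhood of the point
(a neighborhood carries the subspace topology). -/
noncomputable def pointLocalDensity {X : Type u} [TopologicalSpace X] (x : X) : Cardinal.{u} :=
  ⨅ U : {U : Set X // U ∈ 𝓝 x}, density U.1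

/-- The local density of a space: the supremum of the local densities of its points.
The family is indexed by a type in the universe of its values, hence it is bounded. -/
noncomputable def localDensity (X : Type u) [TopologicalSpace X] : Cardinal.{u} :=
  ⨆ x : X, pointLocalDensity x

/-- The local density of the space is attained at some point. -/
def LocalDensityRealized (X : Type u) [TopologicalSpace X] : Prop :=
  ∃ x : X, pointLocalDensity x = localDensity X

/-- `fin(κ)`: the finite subsets of the cardinal `κ`, ordered by inclusion. The cardinal is
regarded as the set of ordinals below its initial ordinal. -/
abbrev FinSub (κ : Cardinal.{u}) : Type u :=
  Finset κ.ord.ToType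

/-- `fin(κ)^ℕ` with the pointwise order. -/
abbrev FinSeq (κ : Cardinal.{u}) : Type u :=
  ℕ → FinSub κ

/-- `Bdd(fin(κ)^ℕ) = ⋃_{α < κ} fin(α)^ℕ`, the union being over the ordinals `α < κ`,
with the order induced from `fin(κ)^ℕ`. -/
abbrev BddFinSeq (κ : Cardinal.{u}) : Type u :=
  {f : FinSeq κ // ∃ α : κ.ord.ToType, ∀ n, ∀ β ∈ f n, β < α}

end CofinalStructure

/-! Write `κ` for the local density of the completion. For the map out of `PK X`, finite marker sets
are chosen so that a precompact set contains only finitely many of them (`exists_markers`);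
recording the contained markers is monotone. Markers in all of `X` give `fin(d(X))`. Markers in
balls of radius `1/(n+1)` about a centre give the `n`-th coordinate; finite sets shrinking to the
centre have precompact union, hence cofinality (`exists_monotone_finSeq`). If `κ` is not realized,
centres of ever larger local density are used, and extra markers let each precompact set see only
finitely many of them, so its sequence is bounded. Conversely, a precompact set has compact closure
in the completion, so it meets finitely many pieces of a cover of size `d(X)`, and each scale needs
finitely many points from enumerated dense subsets of these (`exists_monotone_PK`, `exists_cover`).
-/

namespace CofinalStructure

universe u v w

/-! ### Separated sets and markers -/

section Separated

variable {X : Type u} [PseudoMetricSpace X]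

/-- Every set contains a maximal `ε`-separated subset. -/
theorem exists_separated_net (S : Set X) {ε : ℝ} (hε : 0 < ε) :
    ∃ T ⊆ S, T.Pairwise (fun a b => ε ≤ dist a b) ∧ ∀ x ∈ S, ∃ t ∈ T, dist x t < ε := by
  obtain ⟨T, hT⟩ := zorn_subset {T : Set X | T ⊆ S ∧ T.Pairwise (fun a b => ε ≤ dist a b)} (by
    intro c hc hchain
    refine ⟨⋃₀ c, ⟨Set.sUnion_subset fun t ht => (hc ht).1, ?_⟩,
      fun t ht => Set.subset_sUnion_of_mem ht⟩
    exact (Set.pairwise_sUnion hchain.directedOn).2 fun t ht => (hc ht).2)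
  refine ⟨T, hT.prop.1, hT.prop.2, fun x hx => ?_⟩
  by_contra! h
  have hins : insert x T ⊆ T := hT.le_of_ge (y := insert x T)
    ⟨Set.insert_subset hx hT.prop.1, hT.prop.2.insert fun b hb _ =>
      ⟨h b hb, by rw [dist_comm]; exact h b hb⟩⟩ (Set.subset_insert x T)
  have := h x (hins (Set.mem_insert x T))
  rw [dist_self] at this
  linarith

/-- A totally bounded `ε`-separated set is finite. -/
theorem finite_of_totallyBounded_of_separated {T : Set X} (hT : TotallyBounded T) {ε : ℝ}
    (hε : 0 < ε) (hsep : T.Pairwise (fun a b => ε ≤ dist a b)) : T.Finite := by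
  obtain ⟨t, htf, ht⟩ := Metric.totallyBounded_iff.1 hT (ε / 2) (half_pos hε)
  have hsub : T ⊆ ⋃ y ∈ t, Metric.ball y (ε / 2) ∩ T := by
    intro x hx
    obtain ⟨y, hy, hxy⟩ := Set.mem_iUnion₂.1 (ht hx)
    exact Set.mem_iUnion₂.2 ⟨y, hy, hxy, hx⟩
  refine (htf.biUnion fun y _ => Set.Subsingleton.finite ?_).subset hsub
  rintro a ⟨ha, haT⟩ b ⟨hb, hbT⟩
  by_contra hab
  have h1 := hsep haT hbT hab
  have h2 := dist_triangle_right a b y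
  rw [Metric.mem_ball] at ha hb
  linarith

/-- If `S` is not totally bounded and its dense subsets have at least `#I` elements, then there is
an `I`-indexed family of finite subsets of `S` such that any totally bounded set contains only
finitely many members of the family. -/
theorem exists_markers {I : Type u} {S : Set X} (hS : ¬ TotallyBounded S)
    (hI : ∀ E ⊆ S, S ⊆ closure E → #I ≤ #E) :
    ∃ x : I → Set X, (∀ i, (x i).Finite ∧ x i ⊆ S) ∧
      ∀ P, TotallyBounded P → {i | x i ⊆ P}.Finite := by
  choose D hDS hDsep hDnet using fun n : ℕ =>
    exists_separated_net S (Nat.one_div_pos_of_nat (α := ℝ) (n := n))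
  obtain ⟨N, hN⟩ : ∃ N, (D N).Infinite := by
    by_contra! h
    refine hS (Metric.totallyBounded_iff.2 fun ε hε => ?_)
    obtain ⟨n, hn⟩ := exists_nat_one_div_lt hε
    refine ⟨D n, h n, fun x hx => ?_⟩
    obtain ⟨t, ht, hxt⟩ := hDnet n x hx
    exact Set.mem_iUnion₂.2 ⟨t, ht, Metric.mem_ball.2 (hxt.trans hn)⟩
  let s := hN.natEmbedding
  -- The union of the nets is dense in `S`.
  have hcard : #I ≤ #(Σ n, D n) := by
    refine (hI (⋃ n, D n) (Set.iUnion_subset hDS) fun x hx => ?_).trans ?_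
    · refine Metric.mem_closure_iff.2 fun ε hε => ?_
      obtain ⟨n, hn⟩ := exists_nat_one_div_lt hε
      obtain ⟨t, ht, hxt⟩ := hDnet n x hx
      exact ⟨t, Set.mem_iUnion.2 ⟨n, ht⟩, hxt.trans hn⟩
    · exact Cardinal.mk_le_of_surjective (Set.sigmaToiUnion_surjective D)
  obtain ⟨g⟩ := hcard
  -- A net point of level `n` is paired with the `n`-th point of one infinite separated set: a
  -- precompact set contains finitely many of the latter, so only finitely many levels occur, each
  -- with finitely many net points.
  refine ⟨fun i => {((g i).2 : X), (s (g i).1 : X)}, fun i => ⟨Set.toFinite _, ?_⟩,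
    fun P hP => ?_⟩
  · rintro z (rfl | rfl)
    · exact hDS _ (g i).2.2
    · exact hDS _ (s (g i).1).2
  · have hfin : ∀ n, (D n ∩ P).Finite := fun n =>
      finite_of_totallyBounded_of_separated (hP.subset Set.inter_subset_right)
        (Nat.one_div_pos_of_nat (α := ℝ) (n := n)) ((hDsep n).mono Set.inter_subset_left)
    have hn : {n | (s n : X) ∈ P}.Finite := by
      refine Set.Finite.of_finite_image ((hfin N).subset ?_)
        (f := fun n => (s n : X)) (Subtype.val_injective.comp s.injective).injOn
      rintro _ ⟨n, hn, rfl⟩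
      exact ⟨(s n).2, hn⟩
    have hB : {q : Σ n, D n | (s q.1 : X) ∈ P ∧ (q.2 : X) ∈ P}.Finite := by
      have : {q : Σ n, D n | (s q.1 : X) ∈ P ∧ (q.2 : X) ∈ P} ⊆
          ⋃ n ∈ {n | (s n : X) ∈ P}, Sigma.mk n '' {d : D n | (d : X) ∈ P} := by
        rintro ⟨n, d⟩ ⟨h1, h2⟩
        exact Set.mem_iUnion₂.2 ⟨n, h1, d, h2, rfl⟩
      refine (hn.biUnion fun n _ => Set.Finite.image _ ?_).subset this
      refine Set.Finite.of_finite_image ((hfin n).subset ?_) Subtype.val_injective.injOn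
      rintro _ ⟨d, hd, rfl⟩
      exact ⟨d.2, hd⟩
    refine (hB.preimage g.injective.injOn).subset fun i hi => ?_
    exact ⟨hi (by simp), hi (by simp)⟩

end Separated

/-! ### The two monotone maps -/

/-- Given centres `y α` near which there are at least `#(I α)` many
separated points at every scale, and markers `m α`, precompact sets are mapped monotonically to
sequences of finite sets, cofinally among the sequences living in some `I α`. -/
theorem exists_monotone_finSeq {X : Type u} [MetricSpace X] {J : Type v} {K : Type u}
    (I : J → Set K) (y : J → UniformSpace.Completion X) (m : J → Set X)
    (hmf : ∀ α, (m α).Finite) (hm : ∀ P, TotallyBounded P → {α | m α ⊆ P}.Finite)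
    (hS : ∀ α, ∀ r > 0, ¬ TotallyBounded {x : X | dist (x : UniformSpace.Completion X) (y α) < r})
    (hI : ∀ α, ∀ r > 0, ∀ E ⊆ {x : X | dist (x : UniformSpace.Completion X) (y α) < r},
      {x : X | dist (x : UniformSpace.Completion X) (y α) < r} ⊆ closure E → #(I α) ≤ #E) :
    ∃ ψ : PK X → ℕ → Finset K, Monotone ψ ∧
      (∀ P, ∃ A : Finset J, ∀ n, ∀ i ∈ ψ P n, ∃ α ∈ A, i ∈ I α) ∧
      ∀ (f : ℕ → Finset K) (α : J), (∀ n, ∀ i ∈ f n, i ∈ I α) → ∃ P, f ≤ ψ P := by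
  choose x hx hxP using fun α (n : ℕ) => exists_markers (I := I α)
    (hS α (1 / ((n : ℝ) + 1)) Nat.one_div_pos_of_nat)
    (hI α (1 / ((n : ℝ) + 1)) Nat.one_div_pos_of_nat)
  have hfin : ∀ (P : PK X) n, {i | ∃ α, m α ⊆ P.1 ∧ ∃ h : i ∈ I α, x α n ⟨i, h⟩ ⊆ P.1}.Finite := by
    intro P n
    have : {i | ∃ α, m α ⊆ P.1 ∧ ∃ h : i ∈ I α, x α n ⟨i, h⟩ ⊆ P.1} ⊆
        ⋃ α ∈ {α | m α ⊆ P.1}, Subtype.val '' {i : I α | x α n i ⊆ P.1} := by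
      rintro i ⟨α, h1, h2, h3⟩
      exact Set.mem_iUnion₂.2 ⟨α, h1, ⟨i, h2⟩, h3, rfl⟩
    exact ((hm P.1 P.2).biUnion fun α _ => (hxP α n P.1 P.2).image _).subset this
  refine ⟨fun P n => (hfin P n).toFinset, ?_, fun P => ⟨(hm P.1 P.2).toFinset, ?_⟩, ?_⟩
  · intro P Q hPQ n i
    simp only [Set.Finite.mem_toFinset, Set.mem_ofPred_eq]
    rintro ⟨α, h1, h2, h3⟩
    exact ⟨α, h1.trans hPQ, h2, h3.trans hPQ⟩
  · intro n i
    simp only [Set.Finite.mem_toFinset, Set.mem_ofPred_eq]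
    rintro ⟨α, h1, h2, h3⟩
    exact ⟨α, h1, h2⟩
  · intro f α hf
    let Q : ℕ → Set X := fun n => ⋃ i : f n, x α n ⟨i, hf n i i.2⟩
    have hQf : ∀ n, (Q n).Finite := fun n => Set.finite_iUnion fun i => (hx α n _).1
    -- All but finitely many of the finite sets `Q n` lie within `ε` of `y α`.
    have hQ : TotallyBounded (⋃ n, Q n) := by
      have himg : TotallyBounded ((fun z : X => (z : UniformSpace.Completion X)) '' ⋃ n, Q n) := by
        refine Metric.totallyBounded_iff.2 fun ε hε => ?_
        obtain ⟨N, hN⟩ := exists_nat_one_div_lt hε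
        refine ⟨insert (y α) ((fun z : X => (z : UniformSpace.Completion X)) ''
            ⋃ n ∈ Finset.range N, Q n),
          (((Finset.range N).finite_toSet.biUnion fun n _ => hQf n).image _).insert _, ?_⟩
        rintro _ ⟨z, hz, rfl⟩
        obtain ⟨n, hn⟩ := Set.mem_iUnion.1 hz
        by_cases hnN : n < N
        · refine Set.mem_iUnion₂.2 ⟨z, Or.inr ⟨z, ?_, rfl⟩, Metric.mem_ball_self hε⟩
          exact Set.mem_iUnion₂.2 ⟨n, Finset.mem_range.2 hnN, hn⟩
        · refine Set.mem_iUnion₂.2 ⟨y α, Or.inl rfl, ?_⟩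
          obtain ⟨i, hi⟩ := Set.mem_iUnion.1 hn
          refine Metric.mem_ball.2 (lt_of_lt_of_le ((hx α n _).2 hi) ?_)
          exact (Nat.one_div_le_one_div (not_lt.1 hnN)).trans hN.le
      exact (totallyBounded_preimage (UniformSpace.Completion.isUniformInducing_coe X) himg).subset
        (Set.subset_preimage_image _ _)
    refine ⟨⟨(⋃ n, Q n) ∪ m α, hQ.union (hmf α).totallyBounded⟩, fun n i hi => ?_⟩
    simp only [Set.Finite.mem_toFinset, Set.mem_ofPred_eq]
    refine ⟨α, Set.subset_union_right, hf n i hi, Set.Subset.trans ?_ Set.subset_union_left⟩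
    exact (Set.subset_iUnion (fun i : f n => x α n ⟨i, hf n i i.2⟩) ⟨i, hi⟩).trans
      (Set.subset_iUnion Q n)

/-- Precompact sets are approximated by countably many finite choices of centres. -/
theorem exists_monotone_PK {X : Type u} [MetricSpace X] {L : Type v} {K : Type w}
    (I : L → Set K) (U : L → Set (UniformSpace.Completion X)) (hU : ∀ i, IsOpen (U i))
    (hcov : ∀ z, ∃ i, z ∈ U i) (e : L → K → UniformSpace.Completion X)
    (he : ∀ i, U i ⊆ closure (e i '' I i)) :
    ∃ Φ : Finset L × (ℕ → Finset K) → PK X, Monotone Φ ∧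
      ∀ P : PK X, ∃ F f, P ≤ Φ (F, f) ∧ ∀ n, ∀ j ∈ f n, ∃ i ∈ F, j ∈ I i := by
  classical
  let Φ : Finset L × (ℕ → Finset K) → Set X := fun q =>
    {x | ∀ n : ℕ, ∃ i ∈ q.1, ∃ j ∈ q.2 n,
      dist (x : UniformSpace.Completion X) (e i j) < 1 / ((n : ℝ) + 1)}
  have hΦ : ∀ q, TotallyBounded (Φ q) := by
    intro q
    have himg : TotallyBounded ((fun z : X => (z : UniformSpace.Completion X)) '' Φ q) := by
      refine Metric.totallyBounded_iff.2 fun ε hε => ?_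
      obtain ⟨n, hn⟩ := exists_nat_one_div_lt hε
      refine ⟨⋃ i ∈ q.1, ⋃ j ∈ q.2 n, {e i j}, q.1.finite_toSet.biUnion fun i _ =>
        (q.2 n).finite_toSet.biUnion fun j _ => Set.finite_singleton _, ?_⟩
      rintro _ ⟨z, hz, rfl⟩
      obtain ⟨i, hi, j, hj, hd⟩ := hz n
      refine Set.mem_iUnion₂.2 ⟨e i j, ?_, Metric.mem_ball.2 (hd.trans hn)⟩
      exact Set.mem_iUnion₂.2 ⟨i, hi, Set.mem_iUnion₂.2 ⟨j, hj, rfl⟩⟩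
    exact (totallyBounded_preimage (UniformSpace.Completion.isUniformInducing_coe X) himg).subset
      (Set.subset_preimage_image _ _)
  refine ⟨fun q => ⟨Φ q, hΦ q⟩, fun q q' hq x hx n => ?_, fun P => ?_⟩
  · obtain ⟨i, hi, j, hj, hd⟩ := hx n
    exact ⟨i, hq.1 hi, j, hq.2 n hj, hd⟩
  · have himg : TotallyBounded ((fun z : X => (z : UniformSpace.Completion X)) '' P.1) :=
      P.2.image (UniformSpace.Completion.uniformContinuous_coe X)
    obtain ⟨F, hF⟩ := (himg.closure.isCompact_of_isClosed isClosed_closure).elim_finite_subcover U hU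
      fun z _ => Set.mem_iUnion.2 (hcov z)
    have hPF : ∀ x ∈ P.1, ∃ i ∈ F, (x : UniformSpace.Completion X) ∈ U i := fun x hx => by
      simpa using hF (subset_closure ⟨x, hx, rfl⟩)
    have key : ∀ n : ℕ, ∃ s : Finset K, (∀ j ∈ s, ∃ i ∈ F, j ∈ I i) ∧
        ∀ x ∈ P.1, ∃ i ∈ F, ∃ j ∈ s,
          dist (x : UniformSpace.Completion X) (e i j) < 1 / ((n : ℝ) + 1) := by
      intro n
      have hpos : (0 : ℝ) < 1 / ((n : ℝ) + 1) / 2 := half_pos Nat.one_div_pos_of_nat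
      obtain ⟨t, htP, htf, ht⟩ := Metric.finite_approx_of_totallyBounded P.2 _ hpos
      have hc : ∀ p ∈ t, ∃ j, ∃ i ∈ F, j ∈ I i ∧
          dist (p : UniformSpace.Completion X) (e i j) < 1 / ((n : ℝ) + 1) / 2 := by
        intro p hp
        obtain ⟨i, hi, hpi⟩ := hPF p (htP hp)
        obtain ⟨_, ⟨j, hj, rfl⟩, hd⟩ := Metric.mem_closure_iff.1 (he i hpi) _ hpos
        exact ⟨j, i, hi, hj, hd⟩
      have := htf.fintype
      choose j hj using fun p : t => hc p p.2
      refine ⟨Finset.univ.image j, ?_, fun x hx => ?_⟩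
      · intro k hk
        obtain ⟨p, -, rfl⟩ := Finset.mem_image.1 hk
        obtain ⟨i, hi, hji, -⟩ := hj p
        exact ⟨i, hi, hji⟩
      · obtain ⟨p, hp, hxp⟩ := Set.mem_iUnion₂.1 (ht hx)
        obtain ⟨i, hi, -, hd⟩ := hj ⟨p, hp⟩
        refine ⟨i, hi, j ⟨p, hp⟩, Finset.mem_image_of_mem _ (Finset.mem_univ _), ?_⟩
        have h1 := dist_triangle (x : UniformSpace.Completion X) p (e i (j ⟨p, hp⟩))
        rw [UniformSpace.Completion.dist_eq] at h1
        rw [Metric.mem_ball] at hxp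
        linarith
    choose f hf1 hf2 using key
    exact ⟨F, f, fun x hx n => hf2 n x hx, hf1⟩

/-! ### Density and local density -/

section Density

theorem density_le {X : Type u} [TopologicalSpace X] {D : Set X} (hD : Dense D) :
    density X ≤ #D :=
  ciInf_le' (fun D : {D : Set X // Dense D} => #D.1) ⟨D, hD⟩

theorem exists_dense_card_eq (X : Type u) [TopologicalSpace X] :
    ∃ D : Set X, Dense D ∧ #D = density X := by
  have : Nonempty {D : Set X // Dense D} := ⟨⟨Set.univ, dense_univ⟩⟩
  obtain ⟨D, hD⟩ := ciInf_mem fun D : {D : Set X // Dense D} => #D.1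
  exact ⟨D.1, D.2, hD⟩

theorem pointLocalDensity_le {X : Type u} [TopologicalSpace X] {x : X} {U : Set X}
    (hU : U ∈ 𝓝 x) {D : Set X} (hDU : D ⊆ U) (hD : U ⊆ closure D) :
    pointLocalDensity x ≤ #D := by
  refine (ciInf_le' (fun U : {U : Set X // U ∈ 𝓝 x} => density U.1) ⟨U, hU⟩).trans ?_
  have hdense : Dense ((↑) ⁻¹' D : Set U) := by
    rw [Subtype.dense_iff, Subtype.image_preimage_coe, Set.inter_eq_right.2 hDU]
    exact hD
  exact (density_le hdense).trans (Cardinal.mk_preimage_of_injective _ _ Subtype.val_injective)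

theorem exists_nhds_card_eq {X : Type u} [TopologicalSpace X] (x : X) :
    ∃ U ∈ 𝓝 x, ∃ E : Set X, U ⊆ closure E ∧ #E = pointLocalDensity x := by
  have : Nonempty {U : Set X // U ∈ 𝓝 x} := ⟨⟨Set.univ, Filter.univ_mem⟩⟩
  obtain ⟨U, hU⟩ := ciInf_mem fun U : {U : Set X // U ∈ 𝓝 x} => density U.1
  obtain ⟨D, hD, hDc⟩ := exists_dense_card_eq U.1
  exact ⟨U.1, U.2, (↑) '' D, Subtype.dense_iff.1 hD,
    (Cardinal.mk_image_eq Subtype.val_injective).trans (hDc.trans hU)⟩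

theorem pointLocalDensity_le_localDensity {X : Type u} [TopologicalSpace X] (x : X) :
    pointLocalDensity x ≤ localDensity X :=
  le_ciSup (bddAbove_of_small) x

theorem aleph0_le_mk_of_not_totallyBounded {X : Type u} [UniformSpace X] {S E : Set X}
    (hS : ¬ TotallyBounded S) (hE : S ⊆ closure E) : ℵ₀ ≤ #E := by
  by_contra! h
  exact hS ((Cardinal.lt_aleph0_iff_set_finite.1 h).totallyBounded.closure.subset hE)

theorem aleph0_le_pointLocalDensity {X : Type u} [TopologicalSpace X] [T1Space X] {x : X}
    (hx : ∀ C : Set X, IsCompact C → C ∉ 𝓝 x) : ℵ₀ ≤ pointLocalDensity x := by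
  obtain ⟨U, hU, E, hUE, hE⟩ := exists_nhds_card_eq x
  by_contra! h
  have hfin : E.Finite := Cardinal.lt_aleph0_iff_set_finite.1 (hE.trans_lt h)
  rw [hfin.isClosed.closure_eq] at hUE
  exact hx E hfin.isCompact (Filter.mem_of_superset hU hUE)

theorem pointLocalDensity_le_aleph0 {X : Type u} [MetricSpace X] {x : X} {C : Set X}
    (hC : IsCompact C) (hCx : C ∈ 𝓝 x) : pointLocalDensity x ≤ ℵ₀ := by
  obtain ⟨D, hDC, hD, hCD⟩ := hC.isSeparable.exists_countable_dense_subset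
  exact (pointLocalDensity_le hCx hDC hCD).trans (Cardinal.le_aleph0_iff_set_countable.2 hD)

end Density

/-! ### Passing between `X` and its completion -/

section Completion

variable {X : Type u} [MetricSpace X]

theorem subset_closure_image_coe {U : Set (UniformSpace.Completion X)} (hU : IsOpen U) {E : Set X}
    (hE : {x : X | (x : UniformSpace.Completion X) ∈ U} ⊆ closure E) :
    U ⊆ closure ((fun x : X => (x : UniformSpace.Completion X)) '' E) := by
  refine (UniformSpace.Completion.denseRange_coe.open_subset_closure_inter hU).trans ?_
  refine closure_minimal ?_ isClosed_closure
  rintro _ ⟨hx, x, rfl⟩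
  exact image_closure_subset_closure_image (UniformSpace.Completion.continuous_coe X)
    ⟨x, hE hx, rfl⟩

theorem pointLocalDensity_completion_le {y : UniformSpace.Completion X}
    {U : Set (UniformSpace.Completion X)} (hU : IsOpen U) (hy : y ∈ U) {E : Set X}
    (hEU : E ⊆ {x : X | (x : UniformSpace.Completion X) ∈ U})
    (hE : {x : X | (x : UniformSpace.Completion X) ∈ U} ⊆ closure E) :
    pointLocalDensity y ≤ #E := by
  refine (pointLocalDensity_le (hU.mem_nhds hy) ?_ (subset_closure_image_coe hU hE)).trans
    Cardinal.mk_image_le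
  rintro _ ⟨x, hx, rfl⟩
  exact hEU hx

theorem not_totallyBounded_of_not_compact_nhds {y : UniformSpace.Completion X}
    (hy : ∀ C : Set (UniformSpace.Completion X), IsCompact C → C ∉ 𝓝 y)
    {U : Set (UniformSpace.Completion X)} (hU : IsOpen U) (hyU : y ∈ U) :
    ¬ TotallyBounded {x : X | (x : UniformSpace.Completion X) ∈ U} := by
  intro h
  have himg := h.image (UniformSpace.Completion.uniformContinuous_coe X)
  exact hy _ (himg.closure.isCompact_of_isClosed isClosed_closure)
    (Filter.mem_of_superset (hU.mem_nhds hyU) (subset_closure_image_coe hU subset_closure))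

theorem exists_point_without_compact_nhds {Y : Type u} [TopologicalSpace Y] [R1Space Y]
    (hY : ¬ LocallyCompactSpace Y) : ∃ y : Y, ∀ C : Set Y, IsCompact C → C ∉ 𝓝 y := by
  by_contra! h
  have : WeaklyLocallyCompactSpace Y := ⟨fun y => by
    obtain ⟨C, hC, hCy⟩ := h y
    exact ⟨C, hC, hCy⟩⟩
  exact hY inferInstance

end Completion

/-! ### Cofinal maps -/

section Order

theorem CofinalMapTo.trans {P : Type u} {Q : Type v} {R : Type w} [PartialOrder P] [PartialOrder Q]
    [PartialOrder R] (h₁ : CofinalMapTo P Q) (h₂ : CofinalMapTo Q R) : CofinalMapTo P R := by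
  obtain ⟨f, hf, hfc⟩ := h₁
  obtain ⟨g, hg, hgc⟩ := h₂
  refine ⟨g ∘ f, hg.comp hf, fun r => ?_⟩
  obtain ⟨_, ⟨q, rfl⟩, hq⟩ := hgc r
  obtain ⟨_, ⟨p, rfl⟩, hp⟩ := hfc q
  exact ⟨_, ⟨p, rfl⟩, hq.trans (hg hp)⟩

theorem CofinallyEquivalent.trans {P : Type u} {Q : Type v} {R : Type w} [PartialOrder P]
    [PartialOrder Q] [PartialOrder R] (h₁ : CofinallyEquivalent P Q)
    (h₂ : CofinallyEquivalent Q R) : CofinallyEquivalent P R :=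
  ⟨h₁.1.trans h₂.1, h₂.2.trans h₁.2⟩

theorem CofinalMapTo.prod {P : Type u} {Q : Type v} {R : Type w} [PartialOrder P] [PartialOrder Q]
    [PartialOrder R] (hP : ∀ p p' : P, ∃ q, p ≤ q ∧ p' ≤ q) (h₁ : CofinalMapTo P Q)
    (h₂ : CofinalMapTo P R) : CofinalMapTo P (Q × R) := by
  obtain ⟨f, hf, hfc⟩ := h₁
  obtain ⟨g, hg, hgc⟩ := h₂
  refine ⟨fun p => (f p, g p), fun p p' h => ⟨hf h, hg h⟩, fun ⟨q, r⟩ => ?_⟩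
  obtain ⟨_, ⟨p, rfl⟩, hp⟩ := hfc q
  obtain ⟨_, ⟨p', rfl⟩, hp'⟩ := hgc r
  obtain ⟨s, hs, hs'⟩ := hP p p'
  exact ⟨_, ⟨s, rfl⟩, hp.trans (hf hs), hp'.trans (hg hs')⟩

theorem exists_pk_ge {X : Type u} [UniformSpace X] (P Q : PK X) : ∃ R, P ≤ R ∧ Q ≤ R :=
  ⟨⟨P.1 ∪ Q.1, P.2.union Q.2⟩, Set.subset_union_left, Set.subset_union_right⟩

/-- Markers indexed by `I` yield a cofinal monotone map onto the finite subsets of `I`. -/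
theorem cofinalMapTo_finset {X : Type u} [UniformSpace X] {I : Type v} (m : I → Set X)
    (hmf : ∀ i, (m i).Finite) (hm : ∀ P, TotallyBounded P → {i | m i ⊆ P}.Finite) :
    CofinalMapTo (PK X) (Finset I) := by
  refine ⟨fun P => (hm P.1 P.2).toFinset, fun P Q hPQ => ?_, fun F => ?_⟩
  · exact Set.Finite.toFinset_mono fun i hi => Set.Subset.trans hi hPQ
  · refine ⟨_, ⟨⟨⋃ i ∈ F, m i, (F.finite_toSet.biUnion fun i _ => hmf i).totallyBounded⟩, rfl⟩, ?_⟩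
    intro i hi
    rw [Set.Finite.mem_toFinset]
    exact Set.subset_biUnion_of_mem (u := m) (Finset.mem_coe.2 hi)

end Order

/-! ### Initial segments and cofinality of cardinals -/

section Cardinal

theorem exists_le_mk_Iio {κ c : Cardinal.{u}} (h : c < κ) :
    ∃ α : κ.ord.ToType, c ≤ #(Set.Iio α) := by
  have hlt : c.ord < Ordinal.type (α := κ.ord.ToType) (· < ·) := by
    rw [Ordinal.type_toType]
    exact Cardinal.ord_lt_ord.2 h
  refine ⟨Ordinal.enum (α := κ.ord.ToType) (· < ·) ⟨c.ord, hlt⟩, ?_⟩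
  have := Ordinal.card_typein (α := κ.ord.ToType) (r := (· < ·))
    (Ordinal.enum (α := κ.ord.ToType) (· < ·) ⟨c.ord, hlt⟩)
  rw [Ordinal.typein_enum, Cardinal.card_ord] at this
  exact this.le

theorem exists_subset_image {K : Type u} {Y : Type u} [Nonempty Y] {E : Set Y} {I : Set K}
    (h : #E ≤ #I) : ∃ e : K → Y, E ⊆ e '' I := by
  obtain ⟨g⟩ := h
  have hg : Function.Injective fun x : E => (g x : K) := Subtype.val_injective.comp g.injective
  refine ⟨Function.extend (fun x : E => (g x : K)) Subtype.val fun _ => Classical.arbitrary Y,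
    fun x hx => ⟨g ⟨x, hx⟩, (g ⟨x, hx⟩).2, ?_⟩⟩
  exact hg.extend_apply _ _ (⟨x, hx⟩ : E)

/-- The terms of `f` have countable union, too small to be cofinal. Hence the two sequence posets
coincide for uncountable cofinality. -/
theorem finSeq_bounded {κ : Cardinal.{u}} (hκ : ℵ₀ < κ.ord.cof) (f : FinSeq κ) :
    ∃ α : κ.ord.ToType, ∀ n, ∀ β ∈ f n, β < α := by
  by_contra! h
  have hc : IsCofinal {β | ∃ n, β ∈ f n} := fun α => by
    obtain ⟨n, β, hβ, hle⟩ := h α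
    exact ⟨β, ⟨n, hβ⟩, hle⟩
  have hcount : {β | ∃ n, β ∈ f n}.Countable := by
    rw [Set.ofPred_exists]
    exact Set.countable_iUnion fun n => (f n).countable_toSet
  have h1 := Order.cof_le hc
  rw [Ordinal.cof_toType] at h1
  exact (hκ.trans_le h1).not_ge (Cardinal.le_aleph0_iff_set_countable.2 hcount)

theorem cofinallyEquivalent_bddFinSeq {A : Type v} [PartialOrder A] {κ : Cardinal.{u}}
    (hκ : ℵ₀ < κ.ord.cof) : CofinallyEquivalent (A × BddFinSeq κ) (A × FinSeq κ) := by
  refine ⟨⟨fun p => (p.1, p.2.1), fun p q h => h, fun p => ?_⟩,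
    ⟨fun p => (p.1, ⟨p.2, finSeq_bounded hκ p.2⟩), fun p q h => h, fun p => ?_⟩⟩
  · exact ⟨_, ⟨(p.1, ⟨p.2, finSeq_bounded hκ p.2⟩), rfl⟩, le_rfl⟩
  · exact ⟨_, ⟨(p.1, p.2.1), rfl⟩, le_rfl⟩

end Cardinal

/-! ### Covers of the completion of size `d(X)` -/

section Cover

variable {X : Type u} [MetricSpace X]

/-- Balls of radius `1/(n+1)` about a dense set of size `d(X)` suffice, since `d(X)·ℵ₀ = d(X)`. A
ball with no suitable enumeration is replaced by the empty set. -/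
theorem exists_cover {K : Type w} (hX : ℵ₀ ≤ density X) (𝓘 : Set (Set K))
    (h : ∀ z : UniformSpace.Completion X, ∃ U ∈ 𝓝 z, ∃ e : K → UniformSpace.Completion X,
      ∃ I ∈ 𝓘, U ⊆ closure (e '' I)) :
    ∃ (I : (density X).ord.ToType → Set K)
      (U : (density X).ord.ToType → Set (UniformSpace.Completion X))
      (e : (density X).ord.ToType → K → UniformSpace.Completion X),
      (∀ i, IsOpen (U i)) ∧ (∀ z, ∃ i, z ∈ U i) ∧ (∀ i, U i ⊆ closure (e i '' I i)) ∧
      ∀ i, I i ∈ 𝓘 := by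
  obtain ⟨D, hD, hDc⟩ := exists_dense_card_eq X
  have hDinf : ℵ₀ ≤ #D := hDc ▸ hX
  obtain ⟨g⟩ : Nonempty ((density X).ord.ToType ≃ D × ℕ) := by
    rw [← Cardinal.eq, Cardinal.mk_ord_toType, Cardinal.mk_prod, Cardinal.lift_uzero,
      Cardinal.mk_nat, Cardinal.lift_aleph0, Cardinal.mul_aleph0_eq hDinf, hDc]
  have : Infinite D := Cardinal.infinite_iff.2 hDinf
  obtain ⟨d₀⟩ : Nonempty D := inferInstance
  obtain ⟨-, -, e₀, I₀, hI₀, -⟩ := h (d₀ : X)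
  let B : D × ℕ → Set (UniformSpace.Completion X) := fun q =>
    Metric.ball ((q.1 : X) : UniformSpace.Completion X) (1 / ((q.2 : ℝ) + 1))
  have key : ∀ q : D × ℕ, ∃ (U : Set (UniformSpace.Completion X))
      (e : K → UniformSpace.Completion X) (I : Set K), IsOpen U ∧ I ∈ 𝓘 ∧ U ⊆ closure (e '' I) ∧
      ((∃ e : K → UniformSpace.Completion X, ∃ I ∈ 𝓘, B q ⊆ closure (e '' I)) → U = B q) := by
    intro q
    by_cases hq : ∃ e : K → UniformSpace.Completion X, ∃ I ∈ 𝓘, B q ⊆ closure (e '' I)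
    · obtain ⟨e, I, hI, hB⟩ := hq
      exact ⟨B q, e, I, Metric.isOpen_ball, hI, hB, fun _ => rfl⟩
    · exact ⟨∅, e₀, I₀, isOpen_empty, hI₀, Set.empty_subset _, fun h => (hq h).elim⟩
  choose U e I hU hI hUe hUB using key
  refine ⟨fun i => I (g i), fun i => U (g i), fun i => e (g i), fun i => hU _, fun z => ?_,
    fun i => hUe _, fun i => hI _⟩
  obtain ⟨V, hV, e, I, hI, hVe⟩ := h z
  obtain ⟨r, hr, hrV⟩ := Metric.mem_nhds_iff.1 hV
  obtain ⟨n, hn⟩ := exists_nat_one_div_lt (half_pos hr)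
  have hdense : Dense ((fun x : X => (x : UniformSpace.Completion X)) '' D) :=
    UniformSpace.Completion.denseRange_coe.dense_image
      (UniformSpace.Completion.continuous_coe X) hD
  obtain ⟨_, ⟨d, hd, rfl⟩, hzd⟩ := hdense.exists_dist_lt z
    (Nat.one_div_pos_of_nat (α := ℝ) (n := n))
  refine ⟨g.symm (⟨d, hd⟩, n), ?_⟩
  beta_reduce
  rw [Equiv.apply_symm_apply, hUB]
  · exact hzd
  · refine ⟨e, I, hI, Set.Subset.trans (fun w hw => hrV ?_) hVe⟩
    have h1 := dist_triangle w d z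
    have h2 := Metric.mem_ball.1 hw
    rw [dist_comm] at hzd
    rw [Metric.mem_ball]
    linarith

end Cover

/-! ### The comparisons with `PK X` -/

section Main

variable {X : Type u} [MetricSpace X]

theorem not_totallyBounded_univ (hX : ¬ LocallyCompactSpace (UniformSpace.Completion X)) :
    ¬ TotallyBounded (Set.univ : Set X) := by
  obtain ⟨y, hy⟩ := exists_point_without_compact_nhds hX
  exact not_totallyBounded_of_not_compact_nhds hy isOpen_univ (Set.mem_univ y)

theorem aleph0_le_density (hX : ¬ LocallyCompactSpace (UniformSpace.Completion X)) :
    ℵ₀ ≤ density X := by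
  obtain ⟨D, hD, hDc⟩ := exists_dense_card_eq X
  rw [← hDc]
  exact aleph0_le_mk_of_not_totallyBounded (not_totallyBounded_univ hX) fun x _ => hD x

theorem aleph0_le_localDensity (hX : ¬ LocallyCompactSpace (UniformSpace.Completion X)) :
    ℵ₀ ≤ localDensity (UniformSpace.Completion X) := by
  obtain ⟨y, hy⟩ := exists_point_without_compact_nhds hX
  exact (aleph0_le_pointLocalDensity hy).trans (pointLocalDensity_le_localDensity y)

theorem localDensity_completion_le {E : Set X} (hE : Set.univ ⊆ closure E) :
    localDensity (UniformSpace.Completion X) ≤ #E :=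
  ciSup_le' fun y =>
    pointLocalDensity_completion_le (y := y) isOpen_univ (Set.mem_univ _) (fun _ _ => trivial) hE

theorem not_compact_nhds_of_aleph0_lt {y : UniformSpace.Completion X}
    (hy : ℵ₀ < pointLocalDensity y) (C : Set (UniformSpace.Completion X)) (hC : IsCompact C) :
    C ∉ 𝓝 y :=
  fun hCy => (pointLocalDensity_le_aleph0 hC hCy).not_gt hy

theorem cofinalMapTo_finSub_density (hX : ¬ LocallyCompactSpace (UniformSpace.Completion X)) :
    CofinalMapTo (PK X) (FinSub (density X)) := by
  obtain ⟨m, hm, hmP⟩ := exists_markers (I := (density X).ord.ToType)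
    (not_totallyBounded_univ hX) fun E _ hE => by
      rw [Cardinal.mk_ord_toType]
      exact density_le fun x => hE (Set.mem_univ x)
  exact cofinalMapTo_finset m (fun i => (hm i).1) hmP

theorem cofinalMapTo_finSeq (hX : ¬ LocallyCompactSpace (UniformSpace.Completion X))
    (hr : LocalDensityRealized (UniformSpace.Completion X)) :
    CofinalMapTo (PK X) (FinSeq (localDensity (UniformSpace.Completion X))) := by
  obtain ⟨y, hy, hyκ⟩ : ∃ y : UniformSpace.Completion X,
      (∀ C : Set (UniformSpace.Completion X), IsCompact C → C ∉ 𝓝 y) ∧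
      localDensity (UniformSpace.Completion X) ≤ pointLocalDensity y := by
    -- If `κ = ℵ₀`, a realizing point may have a compact neighborhood, so a point without one is
    -- used; its local density is at least `ℵ₀`. For larger `κ` no realizing point has one.
    rcases (aleph0_le_localDensity hX).eq_or_lt with h | h
    · obtain ⟨y, hy⟩ := exists_point_without_compact_nhds hX
      exact ⟨y, hy, h ▸ aleph0_le_pointLocalDensity hy⟩
    · obtain ⟨y, hy⟩ := hr
      exact ⟨y, not_compact_nhds_of_aleph0_lt (hy ▸ h), hy.ge⟩
  obtain ⟨ψ, hψ, -, hψc⟩ := exists_monotone_finSeq (J := Unit)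
    (K := (localDensity (UniformSpace.Completion X)).ord.ToType)
    (fun _ => Set.univ) (fun _ => y) (fun _ => (∅ : Set X)) (fun _ => Set.finite_empty)
    (fun _ _ => Set.toFinite _)
    (fun _ r hr => not_totallyBounded_of_not_compact_nhds hy Metric.isOpen_ball
      (Metric.mem_ball_self hr))
    (fun _ r hr E hE hEc => by
      rw [Cardinal.mk_univ, Cardinal.mk_ord_toType]
      exact hyκ.trans (pointLocalDensity_completion_le Metric.isOpen_ball
        (Metric.mem_ball_self hr) hE hEc))
  refine ⟨ψ, hψ, fun f => ?_⟩
  obtain ⟨P, hP⟩ := hψc f () fun _ _ _ => Set.mem_univ _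
  exact ⟨_, ⟨P, rfl⟩, hP⟩

theorem cofinalMapTo_bddFinSeq (hX : ¬ LocallyCompactSpace (UniformSpace.Completion X))
    (hr : ¬ LocalDensityRealized (UniformSpace.Completion X)) :
    CofinalMapTo (PK X) (BddFinSeq (localDensity (UniformSpace.Completion X))) := by
  have hκ : ℵ₀ < localDensity (UniformSpace.Completion X) := by
    obtain ⟨y, hy⟩ := exists_point_without_compact_nhds hX
    exact (aleph0_le_pointLocalDensity hy).trans_lt
      ((pointLocalDensity_le_localDensity y).lt_of_ne fun h => hr ⟨y, h⟩)
  obtain ⟨m, hm, hmP⟩ := exists_markers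
    (I := (localDensity (UniformSpace.Completion X)).ord.ToType)
    (not_totallyBounded_univ hX) fun E _ hE => by
      rw [Cardinal.mk_ord_toType]
      exact localDensity_completion_le hE
  -- The `ℵ₀` in the maximum rules out compact neighborhoods of the centre.
  have hy : ∀ α : (localDensity (UniformSpace.Completion X)).ord.ToType,
      ∃ y : UniformSpace.Completion X, max #(Set.Iio α) ℵ₀ < pointLocalDensity y := fun α =>
    exists_lt_of_lt_ciSup' (max_lt ((Cardinal.mk_Iio_lt α (by simp)).trans_eq
      (Cardinal.mk_ord_toType _)) hκ)
  choose y hy using hy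
  obtain ⟨ψ, hψ, hψb, hψc⟩ := exists_monotone_finSeq (fun α => Set.Iio α) y m (fun α => (hm α).1)
    hmP
    (fun α r hr => not_totallyBounded_of_not_compact_nhds
      (not_compact_nhds_of_aleph0_lt ((le_max_right _ _).trans_lt (hy α))) Metric.isOpen_ball
      (Metric.mem_ball_self hr))
    (fun α r hr E hE hEc => ((le_max_left _ _).trans (hy α).le).trans
      (pointLocalDensity_completion_le Metric.isOpen_ball (Metric.mem_ball_self hr) hE hEc))
  have hne : Nonempty (localDensity (UniformSpace.Completion X)).ord.ToType := by
    rw [← Cardinal.mk_ne_zero_iff, Cardinal.mk_ord_toType]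
    exact (Cardinal.aleph0_pos.trans hκ).ne'
  refine ⟨fun P => ⟨ψ P, ?_⟩, fun P Q hPQ => hψ hPQ, fun f => ?_⟩
  · obtain ⟨A, hA⟩ := hψb P
    -- Only finitely many centres contribute, so the largest index is a bound.
    obtain ⟨M, hM⟩ := A.exists_le
    refine ⟨M, fun n β hβ => ?_⟩
    obtain ⟨α, hα, hβα⟩ := hA n β hβ
    exact lt_of_lt_of_le hβα (hM α hα)
  · obtain ⟨α, hα⟩ := f.2
    obtain ⟨P, hP⟩ := hψc f.1 α hα
    exact ⟨_, ⟨P, rfl⟩, hP⟩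

theorem prod_finSeq_cofinalMapTo (hX : ¬ LocallyCompactSpace (UniformSpace.Completion X)) :
    CofinalMapTo (FinSub (density X) × FinSeq (localDensity (UniformSpace.Completion X)))
      (PK X) := by
  obtain ⟨I, U, e, hU, hcov, he, -⟩ := exists_cover
    (K := (localDensity (UniformSpace.Completion X)).ord.ToType) (aleph0_le_density hX)
    {Set.univ} fun z => by
      obtain ⟨U, hU, E, hUE, hE⟩ := exists_nhds_card_eq z
      have : Nonempty (UniformSpace.Completion X) := ⟨z⟩
      obtain ⟨e, he⟩ := exists_subset_image (E := E)
        (I := (Set.univ : Set (localDensity (UniformSpace.Completion X)).ord.ToType)) (by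
          rw [Cardinal.mk_univ, Cardinal.mk_ord_toType, hE]
          exact pointLocalDensity_le_localDensity z)
      exact ⟨U, hU, e, _, rfl, hUE.trans (closure_mono he)⟩
  obtain ⟨Φ, hΦ, hΦc⟩ := exists_monotone_PK I U hU hcov e he
  refine ⟨Φ, hΦ, fun P => ?_⟩
  obtain ⟨F, f, hP, -⟩ := hΦc P
  exact ⟨_, ⟨(F, f), rfl⟩, hP⟩

theorem prod_bddFinSeq_cofinalMapTo (hX : ¬ LocallyCompactSpace (UniformSpace.Completion X))
    (hr : ¬ LocalDensityRealized (UniformSpace.Completion X)) :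
    CofinalMapTo (FinSub (density X) × BddFinSeq (localDensity (UniformSpace.Completion X)))
      (PK X) := by
  obtain ⟨I, U, e, hU, hcov, he, hI⟩ := exists_cover
    (K := (localDensity (UniformSpace.Completion X)).ord.ToType) (aleph0_le_density hX)
    (Set.range Set.Iio) fun z => by
      obtain ⟨U, hU, E, hUE, hE⟩ := exists_nhds_card_eq z
      have : Nonempty (UniformSpace.Completion X) := ⟨z⟩
      obtain ⟨α, hα⟩ := exists_le_mk_Iio
        ((pointLocalDensity_le_localDensity z).lt_of_ne fun h => hr ⟨z, h⟩)
      obtain ⟨e, he⟩ := exists_subset_image (hE.trans_le hα)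
      exact ⟨U, hU, e, _, ⟨α, rfl⟩, hUE.trans (closure_mono he)⟩
  choose a ha using hI
  obtain ⟨Φ, hΦ, hΦc⟩ := exists_monotone_PK I U hU hcov e he
  have hne : Nonempty (localDensity (UniformSpace.Completion X)).ord.ToType := by
    rw [← Cardinal.mk_ne_zero_iff, Cardinal.mk_ord_toType]
    exact (Cardinal.aleph0_pos.trans_le (aleph0_le_localDensity hX)).ne'
  refine ⟨fun p => Φ (p.1, p.2.1), fun p q h => hΦ h, fun P => ?_⟩
  obtain ⟨F, f, hP, hf⟩ := hΦc P
  -- Each `I i` is the segment below `a i`; finitely many `i` occur.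
  obtain ⟨M, hM⟩ := (F.image a).exists_le
  refine ⟨_, ⟨(F, ⟨f, M, fun n j hj => ?_⟩), rfl⟩, hP⟩
  obtain ⟨i, hi, hji⟩ := hf n j hj
  rw [← ha i] at hji
  exact lt_of_lt_of_le hji (hM _ (Finset.mem_image_of_mem a hi))

end Main

end CofinalStructure
open CofinalStructure in
theorem mainTheorem1 (X : Type*) [MetricSpace X]
    (hX : ¬ LocallyCompactSpace (UniformSpace.Completion X)) :
    (¬ LocalDensityRealized (UniformSpace.Completion X) →
      CofinallyEquivalent (PK X)
        (FinSub (density X) × BddFinSeq (localDensity (UniformSpace.Completion X)))) ∧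
    (LocalDensityRealized (UniformSpace.Completion X) ∨
        ℵ₀ < (localDensity (UniformSpace.Completion X)).ord.cof →
      CofinallyEquivalent (PK X)
        (FinSub (density X) × FinSeq (localDensity (UniformSpace.Completion X)))) := by
  have hbdd (hr : ¬ LocalDensityRealized (UniformSpace.Completion X)) :
      CofinallyEquivalent (PK X)
        (FinSub (density X) × BddFinSeq (localDensity (UniformSpace.Completion X))) :=
    ⟨(cofinalMapTo_finSub_density hX).prod exists_pk_ge (cofinalMapTo_bddFinSeq hX hr),
      prod_bddFinSeq_cofinalMapTo hX hr⟩
  refine ⟨hbdd, fun h => ?_⟩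
  by_cases hr : LocalDensityRealized (UniformSpace.Completion X)
  · exact ⟨(cofinalMapTo_finSub_density hX).prod exists_pk_ge (cofinalMapTo_finSeq hX hr),
      prod_finSeq_cofinalMapTo hX⟩
  · exact (hbdd hr).trans (cofinallyEquivalent_bddFinSeq (h.resolve_left hr))
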